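/- A comparator $[i:j]$ puts the minimum of the contents of registers $i,j$ into register $i$ and the maximum into register $j$. A stage is a set of comparators connecting disjoint pairs of registers, a comparator network is a sequence of stages $S_1,\dots,S_d$ on a finite set of registers, and its running time is its number of stages $d$. The network is $p$-periodic if $p<d$ and $S_i=S_{i+p}$ for $1\le i\le d-p$. A pass of a network is one run through all of its stages. The delay of a network is the maximum, over all registers $r$ that occur in some stage, of $\mathrm{lst}(r)-\mathrm{fst}(r)+1$, where $\mathrm{fst}(r)$ and $\mathrm{lst}(r)$ are the indices of the first and the last stage in which $r$ occurs. The compact form of a network $S_1,\dots,S_d$ of delay $D$ consists of the $D$ stages $T_q=\bigcup\{S_{q+pD}: 0\le p\le (d-q)/D\}$, $1\le q\le D$. For $k\ge 3$ let $n=2^{k-1}-1$, $b=2(k-2)$ and $N_k=nb=(2^k-2)(k-2)$. Let $P_k$ be the network on the registers $0,1,\dots,N_k+1$ with the stages $S_{k,1}\cup\{[0:1],[N_k:N_k+1]\},\,S_{k,2},\dots,S_{k,2k-3}$, where $$S_{k,1}=\{[bi:bi+1]: 1\le i\le n-1\},$$ and, for $j=1,\dots,k-2$, $$S_{k,2j}=\{[bi+j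 : b(i+2^{k-j-1}-1)+(b-j+1)]: 0\le i\le n-2^{k-j-1}\},$$ $$S_{k,2j+1}=\{[bi+j:bi+j+1],\ [bi+(b-j):bi+(b-j+1)]: 0\le i\le n-1\}.$$ Let $M_k$ be the compact form of $P_k$ with the first and the last register (and the comparators touching them) deleted. Theorem. For every $k\ge 3$, $M_k$ is a comparator network with exactly three stages, on the $N_k=(2^k-2)(k-2)$ registers $1,\dots,N_k$, so that any $t\ge 2$ passes of $M_k$ form a $3$-periodic network. $M_k$ is a $(2k-5)$-pass merger: if the registers contain items of any linearly ordered set such that the sequence in the odd registers and the sequence in the even registers are both sorted, then after $2k-5$ passes of $M_k$ the registers $1,\dots,N_k$ contain the same items in sorted order. The running time, i.e. the number of stages in these $2k-5$ passes, is $6k-15\le 6\log_2 N_k$. -/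

import Mathlib

universe u

/-- A stage: a finite set of comparators. The comparator `[i:j]`, written as the pair `(i, j)`,
puts the minimum of the contents of registers `i` and `j` into register `i`, and the maximum
into register `j`. -/
abbrev Stage := Finset (ℕ × ℕ)

namespace Stage

/-- The registers that are touched by the comparators of a stage. -/
def regs (S : Stage) : Finset ℕ := S.image Prod.fst ∪ S.image Prod.snd

/-- The comparators of the stage connect disjoint pairs of (distinct) registers. -/
def IsValid (S : Stage) : Prop :=
  (∀ c ∈ S, c.1 ≠ c.2) ∧
    ∀ c ∈ S, ∀ c' ∈ S, c ≠ c' →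
      c.1 ≠ c'.1 ∧ c.1 ≠ c'.2 ∧ c.2 ≠ c'.1 ∧ c.2 ≠ c'.2

variable {α : Type u} [LinearOrder α]

/-- The contents of the registers after all comparators of the stage have worked in parallel on
the contents `x`. In a valid stage each register lies on at most one comparator, so the `inf'`
and `sup'` range over one comparator only; see `apply_fst`, `apply_snd`, `apply_of_notMem`. -/
def apply (S : Stage) (x : ℕ → α) : ℕ → α := fun r =>
  if h : (S.filter fun c => c.1 = r).Nonempty then
    (S.filter fun c => c.1 = r).inf' h fun c => min (x c.1) (x c.2)
  else if h : (S.filter fun c => c.2 = r).Nonempty then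
    (S.filter fun c => c.2 = r).sup' h fun c => max (x c.1) (x c.2)
  else x r

theorem apply_fst {S : Stage} (hS : S.IsValid) (x : ℕ → α) {c : ℕ × ℕ} (hc : c ∈ S) :
    S.apply x c.1 = min (x c.1) (x c.2) := by
  have h : (S.filter fun c' => c'.1 = c.1) = {c} := by
    ext c'
    simp only [Finset.mem_filter, Finset.mem_singleton]
    constructor
    · rintro ⟨h1, h2⟩
      by_contra hne
      exact (hS.2 c' h1 c hc hne).1 h2
    · rintro rfl
      exact ⟨hc, rfl⟩
  simp [apply, h]

theorem apply_snd {S : Stage} (hS : S.IsValid) (x : ℕ → α) {c : ℕ × ℕ} (hc : c ∈ S) :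
    S.apply x c.2 = max (x c.1) (x c.2) := by
  have h : (S.filter fun c' => c'.2 = c.2) = {c} := by
    ext c'
    simp only [Finset.mem_filter, Finset.mem_singleton]
    constructor
    · rintro ⟨h1, h2⟩
      by_contra hne
      exact (hS.2 c' h1 c hc hne).2.2.2 h2
    · rintro rfl
      exact ⟨hc, rfl⟩
  have h0 : (S.filter fun c' => c'.1 = c.2) = ∅ := by
    ext c'
    simp only [Finset.mem_filter, Finset.notMem_empty, iff_false, not_and]
    intro h1 h2
    by_cases hne : c' = c
    · subst hne
      exact hS.1 _ h1 h2
    · exact (hS.2 c' h1 c hc hne).2.1 h2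
  simp [apply, h, h0]

theorem apply_of_notMem {S : Stage} (x : ℕ → α) {r : ℕ} (hr : r ∉ S.regs) :
    S.apply x r = x r := by
  simp only [regs, Finset.mem_union, Finset.mem_image, not_or, not_exists, not_and] at hr
  have h1 : (S.filter fun c => c.1 = r) = ∅ := Finset.filter_eq_empty_iff.2 fun c hc => hr.1 c hc
  have h2 : (S.filter fun c => c.2 = r) = ∅ := Finset.filter_eq_empty_iff.2 fun c hc => hr.2 c hc
  simp [apply, h1, h2]

end Stage

/-- A comparator network: a finite set of registers (numbered by natural numbers) and a sequence
of stages `stage 1, …, stage depth`. The values of `stage` at other indices are irrelevant. -/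
structure ComparatorNetwork where
  /-- The registers of the network. -/
  registers : Finset ℕ
  /-- The number of stages, which is the running time of the network. -/
  depth : ℕ
  /-- The stages, numbered from `1` to `depth`. -/
  stage : ℕ → Stage

namespace ComparatorNetwork

/-- Every stage consists of comparators that connect disjoint pairs of registers of the network. -/
def IsValid (A : ComparatorNetwork) : Prop :=
  ∀ i ∈ Finset.Icc 1 A.depth, (A.stage i).IsValid ∧ (A.stage i).regs ⊆ A.registers

/-- The contents of the registers after the first `d` stages. -/
def runUpTo {α : Type u} [LinearOrder α] (A : ComparatorNetwork) (x : ℕ → α) : ℕ → (ℕ → α)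
  | 0 => x
  | d + 1 => (A.stage (d + 1)).apply (A.runUpTo x d)

/-- The output of the network, the stages being run one after another, on the input `x`. -/
def output {α : Type u} [LinearOrder α] (A : ComparatorNetwork) (x : ℕ → α) : ℕ → α :=
  A.runUpTo x A.depth

/-- The network is `p`-periodic: `p` is less than the number of stages, and stages `i` and
`i + p` are identical. -/
def IsPeriodic (A : ComparatorNetwork) (p : ℕ) : Prop :=
  p < A.depth ∧ ∀ i, 1 ≤ i → i + p ≤ A.depth → A.stage i = A.stage (i + p)

/-- The network that runs the whole of `A` repeatedly, `t` times (`t` passes of `A`). -/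
def passes (A : ComparatorNetwork) (t : ℕ) : ComparatorNetwork where
  registers := A.registers
  depth := t * A.depth
  stage i := A.stage ((i - 1) % A.depth + 1)

/-- The numbers of the stages in which register `r` is used. -/
def usedAt (A : ComparatorNetwork) (r : ℕ) : Finset ℕ :=
  (Finset.Icc 1 A.depth).filter fun i => r ∈ (A.stage i).regs

/-- The delay: the maximum over all registers `r` of `lst r - fst r + 1`, where `fst r` and
`lst r` are the numbers of the first and of the last stage in which `r` is used
(unused registers do not count). -/
def delay (A : ComparatorNetwork) : ℕ :=
  A.registers.sup fun r =>
    if h : (A.usedAt r).Nonempty then (A.usedAt r).max' h - (A.usedAt r).min' h + 1 else 0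

/-- The compact form of `A = S_1, …, S_d` is `T_1, …, T_D`, where `D` is the delay of `A` and
`T_q` is the union of all `S_{q + p D}` with `0 ≤ p ≤ (d - q) / D`. -/
def compactForm (A : ComparatorNetwork) : ComparatorNetwork where
  registers := A.registers
  depth := A.delay
  stage q := (Finset.range ((A.depth - q) / A.delay + 1)).biUnion fun p =>
    A.stage (q + p * A.delay)

/-- Delete the registers in `R`, and all comparators that touch them. -/
def deleteRegisters (A : ComparatorNetwork) (R : Finset ℕ) : ComparatorNetwork where
  registers := A.registers \ R
  depth := A.depth
  stage i := (A.stage i).filter fun c => c.1 ∉ R ∧ c.2 ∉ R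

/-- The network merges any two sorted sequences (over any linearly ordered set) that are given in
its registers with odd and with even numbers, respectively: the output is sorted and consists of
the same items as the input. -/
def MergesOddEven (A : ComparatorNetwork) : Prop :=
  ∀ (α : Type u) [LinearOrder α] (x : ℕ → α),
    MonotoneOn x {r | r ∈ A.registers ∧ Odd r} →
    MonotoneOn x {r | r ∈ A.registers ∧ Even r} →
      MonotoneOn (A.output x) {r | r ∈ A.registers} ∧
        A.registers.val.map (A.output x) = A.registers.val.map x

end ComparatorNetwork

namespace PeriodicMerger

/-- `n_k = 2^(k-1) - 1`. -/
def n (k : ℕ) : ℕ := 2 ^ (k - 1) - 1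

/-- `b_k = 2 (k - 2)`. -/
def b (k : ℕ) : ℕ := 2 * (k - 2)

/-- `S_{k,1} = {[b i : b i + 1] : i = 1, …, n - 1}`. -/
def firstStage (k : ℕ) : Stage :=
  (Finset.Icc 1 (n k - 1)).image fun i => (b k * i, b k * i + 1)

/-- The long comparators `S_{k,2j} =
{[b i + j : b (i + 2^(k-j-1) - 1) + (b - j + 1)] : i = 0, …, n - 2^(k-j-1)}`. -/
def longStage (k j : ℕ) : Stage :=
  (Finset.Icc 0 (n k - 2 ^ (k - j - 1))).image fun i =>
    (b k * i + j, b k * (i + 2 ^ (k - j - 1) - 1) + (b k - j + 1))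

/-- The short comparators `S_{k,2j+1} =
{[b i + j : b i + j + 1], [b i + (b - j) : b i + (b - j + 1)] : i = 0, …, n - 1}`. -/
def shortStage (k j : ℕ) : Stage :=
  ((Finset.Icc 0 (n k - 1)).image fun i => (b k * i + j, b k * i + j + 1)) ∪
    (Finset.Icc 0 (n k - 1)).image fun i => (b k * i + (b k - j), b k * i + (b k - j + 1))

/-- The network `P_k`, on the `n b + 2` registers `0, …, n b + 1`, with the stages
`S_{k,1} ∪ {[0:1], [n b : n b + 1]}, S_{k,2}, …, S_{k,2k-3}`. -/
def P (k : ℕ) : ComparatorNetwork where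
  registers := Finset.range (n k * b k + 2)
  depth := 2 * k - 3
  stage m :=
    if m = 1 then firstStage k ∪ {(0, 1), (n k * b k, n k * b k + 1)}
    else if m % 2 = 0 then longStage k (m / 2)
    else shortStage k (m / 2)

/-- The network `M_k`: the compact form of `P_k` with the first and the last register deleted. -/
def M (k : ℕ) : ComparatorNetwork :=
  (P k).compactForm.deleteRegisters {0, n k * b k + 1}

end PeriodicMerger

/-! ### Folding dynamics of K real numbers. -/

namespace PeriodicMerger

/-! Put K = k - 2 and arrange the registers in n rows and 2K columns, with 2Ki + c in row i and
column c. For a threshold a, the items at least a fill an end segment of each column, so a column is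
described by a level. Comparators from column c to column c', δ rows below, turn levels C, C' into
min(C, C' + δ), max(C', C - δ) (`IsLinkStage.hasLevels_apply`). Only integer parts matter and these
operations respect them, so real levels are allowed. Levels of opposite columns c, 2K + 1 - c can be
chosen with constant sum 2s. The network is symmetric under reversal, so this persists, and K
offsets v_j describe everything (`Link.level_foldStep`).

On the offsets, long comparators reflect v_j down at 2^(K-j), the first stage reflects v_1 up at 0,
the central short comparators reflect v_K down at 1/2, and the other short ones sort v_j, v_{j+1}.
The registers are sorted once 0 ≤ v_1 ≤ … ≤ v_K ≤ 1/2 (`level_add_le_level_add`).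

Initially |v_j| ≤ 2^K. Nonnegativity sweeps up from v_1 in two steps per index; the folds, whose
scale halves with each index, do not destroy it. It returns down in one step per index and reaches
v_1, by then at most 1/2, at time 3K. From then on reflection at 0 is idle. A second upward sweep
spreads the bound 1/2, which makes the folds idle, and the order; a last downward sweep completes
the order by time 6K - 3, that is, after 2K - 1 passes of three stages. -/

/-- One step of the folding dynamics on `K` real numbers `v 1, …, v K`. -/
noncomputable def foldStep (K q : ℕ) (v : ℕ → ℝ) (j : ℕ) : ℝ :=
  if q % 3 = 2 * j % 3 then min (v j) (2 ^ (K + 1 - j) - v j)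
  else if q % 3 = (2 * j + 1) % 3 then
    if j < K then min (v j) (v (j + 1)) else min (v j) (1 - v j)
  else if j = 1 then |v 1| else max (v (j - 1)) (v j)

/-- The folding dynamics, with initial values `v`. -/
noncomputable def foldRun (K : ℕ) (v : ℕ → ℝ) : ℕ → ℕ → ℝ
  | 0 => v
  | t + 1 => foldStep K (t + 1) (foldRun K v t)

section foldRun

variable {K : ℕ} {v : ℕ → ℝ} {t j : ℕ}

theorem foldRun_fold (h : (t + 1) % 3 = 2 * j % 3) :
    foldRun K v (t + 1) j = min (foldRun K v t j) (2 ^ (K + 1 - j) - foldRun K v t j) := by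
  simp [foldRun, foldStep, h]

theorem foldRun_lower (hj : j < K) (h : (t + 1) % 3 = (2 * j + 1) % 3) :
    foldRun K v (t + 1) j = min (foldRun K v t j) (foldRun K v t (j + 1)) := by
  have h1 : ¬ (t + 1) % 3 = 2 * j % 3 := by omega
  simp only [foldRun, foldStep, if_neg h1, if_pos h, if_pos hj]

theorem foldRun_upper (hj : 1 ≤ j) (h : (t + 1) % 3 = (2 * j + 1) % 3) :
    foldRun K v (t + 1) (j + 1) = max (foldRun K v t j) (foldRun K v t (j + 1)) := by
  have h1 : ¬ (t + 1) % 3 = 2 * (j + 1) % 3 := by omega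
  have h2 : ¬ (t + 1) % 3 = (2 * (j + 1) + 1) % 3 := by omega
  have h3 : ¬ j + 1 = 1 := by omega
  simp only [foldRun, foldStep, if_neg h1, if_neg h2, if_neg h3, Nat.add_sub_cancel]

theorem foldRun_last (h : (t + 1) % 3 = (2 * K + 1) % 3) :
    foldRun K v (t + 1) K = min (foldRun K v t K) (1 - foldRun K v t K) := by
  have h1 : ¬ (t + 1) % 3 = 2 * K % 3 := by omega
  simp only [foldRun, foldStep, if_neg h1, if_pos h, lt_irrefl, if_false]

theorem foldRun_first (h : (t + 1) % 3 = 1) :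
    foldRun K v (t + 1) 1 = |foldRun K v t 1| := by
  have h1 : ¬ (t + 1) % 3 = 2 * 1 % 3 := by omega
  have h2 : ¬ (t + 1) % 3 = (2 * 1 + 1) % 3 := by omega
  simp only [foldRun, foldStep, if_neg h1, if_neg h2, if_true]

theorem abs_foldRun_le (hv : ∀ j, 1 ≤ j → j ≤ K → |v j| ≤ 2 ^ K) (t : ℕ) :
    ∀ j, 1 ≤ j → j ≤ K → |foldRun K v t j| ≤ 2 ^ K := by
  induction t with
  | zero => exact hv
  | succ t ih =>
    intro j hj hjK
    have ij := ih j hj hjK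
    have hK : (1 : ℝ) ≤ 2 ^ K := one_le_pow₀ (by norm_num)
    simp only [foldRun, foldStep]
    split_ifs with h1 h2 h3 h4
    · have : (0 : ℝ) < 2 ^ (K + 1 - j) := by positivity
      rw [abs_le] at *
      exact ⟨le_min ij.1 (by linarith), (min_le_left _ _).trans ij.2⟩
    · have ij' := ih (j + 1) (by omega) (by omega)
      rw [abs_le] at *
      exact ⟨le_min ij.1 ij'.1, (min_le_left _ _).trans ij.2⟩
    · rw [abs_le] at *
      exact ⟨le_min ij.1 (by linarith), (min_le_left _ _).trans ij.2⟩
    · rw [abs_abs]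
      exact h4 ▸ ij
    · have ij' := ih (j - 1) (by omega) (by omega)
      rw [abs_le] at *
      exact ⟨le_max_of_le_left ij'.1, max_le ij'.2 ij.2⟩

theorem foldRun_le_of_fold (hj : j ≤ K) (ht : 1 ≤ t) (h : t % 3 = 2 * j % 3) :
    foldRun K v t j ≤ 2 ^ (K - j) := by
  obtain ⟨t, rfl⟩ := Nat.exists_eq_add_of_le' ht
  rw [foldRun_fold h, show K + 1 - j = (K - j) + 1 by omega, pow_succ]
  rcases le_total (foldRun K v t j) (2 ^ (K - j)) with h1 | h1
  · exact (min_le_left _ _).trans h1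
  · exact (min_le_right _ _).trans (by linarith)

/-- Reflection at 1/2 creates the bound at index K, and the minima pass it down, one step per index.
-/
theorem foldRun_le_half_of_lower (hj : j ≤ K) (ht : 1 ≤ t) (htj : K + 1 ≤ t + j)
    (h : t % 3 = (2 * j + 1) % 3) : foldRun K v t j ≤ 1 / 2 := by
  induction hj using Nat.decreasingInduction generalizing t with
  | self =>
    obtain ⟨t, rfl⟩ := Nat.exists_eq_add_of_le' ht
    rw [foldRun_last h]
    rcases le_total (foldRun K v t K) (1 / 2) with h1 | h1
    · exact (min_le_left _ _).trans h1
    · exact (min_le_right _ _).trans (by linarith)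
  | of_succ j hj ih =>
    obtain ⟨t, rfl⟩ := Nat.exists_eq_add_of_le' ht
    rw [foldRun_lower hj h]
    exact (min_le_right _ _).trans (ih (by omega) (by omega) (by omega))

/-- For j > 1, v_{j-1} enters the maximum right after its fold at 2^(K+1-j), while v_j was folded at
2^(K-j) two steps earlier and has not grown since. This bound keeps the next fold of v_j from
creating a negative number. -/
theorem foldRun_le_of_upper (hv : ∀ j, 1 ≤ j → j ≤ K → |v j| ≤ 2 ^ K) (hj : 1 ≤ j) (hjK : j ≤ K)
    (htj : 2 * j ≤ t + 1) (h : t % 3 = (2 * j + 2) % 3) :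
    foldRun K v t j ≤ 2 ^ (K + 1 - j) := by
  obtain rfl | hj1 := hj.eq_or_lt
  · exact (le_abs_self _).trans (abs_foldRun_le hv t 1 le_rfl hjK)
  · obtain ⟨j, rfl⟩ := Nat.exists_eq_add_of_le' hj
    obtain ⟨t, rfl⟩ : ∃ s, t = s + 2 := ⟨t - 2, by omega⟩
    rw [foldRun_upper (by omega) (by omega)]
    refine max_le ?_ ?_
    · rw [show K + 1 - (j + 1) = K - j by omega]
      exact foldRun_le_of_fold (by omega) (by omega) (by omega)
    · have h1 : foldRun K v (t + 1) (j + 1) ≤ foldRun K v t (j + 1) := by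
        obtain hK | hK := hjK.eq_or_lt
        · subst hK
          rw [foldRun_last (by omega)]
          exact min_le_left _ _
        · rw [foldRun_lower hK (by omega)]
          exact min_le_left _ _
      have h2 : foldRun K v t (j + 1) ≤ 2 ^ (K - (j + 1)) :=
        foldRun_le_of_fold hjK (by omega) (by omega)
      exact (h1.trans h2).trans (pow_le_pow_right₀ (by norm_num) (by omega))

theorem foldRun_nonneg_of_fold_of_upper (hv : ∀ j, 1 ≤ j → j ≤ K → |v j| ≤ 2 ^ K) (hj : 1 ≤ j)
    (hjK : j ≤ K) (htj : 2 * j ≤ t) (h : t % 3 = 2 * j % 3)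
    (h0 : 0 ≤ foldRun K v (t - 1) j) : 0 ≤ foldRun K v t j := by
  obtain ⟨t, rfl⟩ : ∃ s, t = s + 1 := ⟨t - 1, by omega⟩
  rw [foldRun_fold h]
  exact le_min h0 (sub_nonneg.2 (foldRun_le_of_upper hv hj hjK (by omega) (by omega)))

/-- The absolute value at index 1 starts the first upward sweep: a fold preserves nonnegativity,
then a maximum hands it to the next index, hence two steps per index. -/
theorem foldRun_nonneg_of_upper (hv : ∀ j, 1 ≤ j → j ≤ K → |v j| ≤ 2 ^ K) (hj : 1 ≤ j)
    (hjK : j ≤ K) (htj : 2 * j ≤ t + 1) (h : t % 3 = (2 * j + 2) % 3) :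
    0 ≤ foldRun K v t j := by
  induction j, hj using Nat.le_induction generalizing t with
  | base =>
    obtain ⟨t, rfl⟩ : ∃ s, t = s + 1 := ⟨t - 1, by omega⟩
    rw [foldRun_first (by omega)]
    exact abs_nonneg _
  | succ j hj ih =>
    obtain ⟨t, rfl⟩ : ∃ s, t = s + 1 := ⟨t - 1, by omega⟩
    rw [foldRun_upper hj (by omega)]
    exact le_max_of_le_left (foldRun_nonneg_of_fold_of_upper hv hj (by omega) (by omega) (by omega)
      (ih (by omega) (by omega) (by omega)))

theorem foldRun_nonneg_of_fold (hv : ∀ j, 1 ≤ j → j ≤ K → |v j| ≤ 2 ^ K) (hj : 1 ≤ j)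
    (hjK : j ≤ K) (htj : 2 * j ≤ t) (h : t % 3 = 2 * j % 3) : 0 ≤ foldRun K v t j :=
  foldRun_nonneg_of_fold_of_upper hv hj hjK htj h
    (foldRun_nonneg_of_upper hv hj hjK (by omega) (by omega))

/-- First downward sweep: it starts at index K, where the preceding fold gives v_K ≤ 1 and hence 1 -
v_K ≥ 0, and descends through the minima. -/
theorem foldRun_nonneg_of_lower (hv : ∀ j, 1 ≤ j → j ≤ K → |v j| ≤ 2 ^ K) (hj : 1 ≤ j)
    (hjK : j ≤ K) (htj : 3 * K + 1 ≤ t + j) (h : t % 3 = (2 * j + 1) % 3) :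
    0 ≤ foldRun K v t j := by
  induction hjK using Nat.decreasingInduction generalizing t with
  | self =>
    obtain ⟨t, rfl⟩ : ∃ s, t = s + 1 := ⟨t - 1, by omega⟩
    rw [foldRun_last h]
    have h1 : foldRun K v t K ≤ 2 ^ (K - K) := foldRun_le_of_fold le_rfl (by omega) (by omega)
    rw [Nat.sub_self, pow_zero] at h1
    exact le_min (foldRun_nonneg_of_fold hv hj le_rfl (by omega) (by omega)) (by linarith)
  | of_succ j hjK ih =>
    obtain ⟨t, rfl⟩ : ∃ s, t = s + 1 := ⟨t - 1, by omega⟩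
    rw [foldRun_lower hjK h]
    exact le_min (foldRun_nonneg_of_fold hv hj (by omega) (by omega) (by omega))
      (ih (by omega) (by omega) (by omega))

/-- Once the first number is nonnegative and small, it is not changed by reflection at `0`. -/
theorem foldRun_first_eq (hv : ∀ j, 1 ≤ j → j ≤ K → |v j| ≤ 2 ^ K) (hK : 1 ≤ K)
    (ht : 3 * K ≤ t) (h : t % 3 = 0) : foldRun K v (t + 1) 1 = foldRun K v t 1 := by
  rw [foldRun_first (by omega),
    abs_of_nonneg (foldRun_nonneg_of_lower hv le_rfl hK (by omega) (by omega))]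

/-- Second upward sweep, possible because reflection at 0 no longer turns a large negative v_1 into
a large positive one. -/
theorem foldRun_le_half_of_upper (hv : ∀ j, 1 ≤ j → j ≤ K → |v j| ≤ 2 ^ K) (hj : 1 ≤ j)
    (hjK : j ≤ K) (htj : 3 * K + 2 * j ≤ t + 1) (h : t % 3 = (2 * j + 2) % 3) :
    foldRun K v t j ≤ 1 / 2 := by
  induction j, hj using Nat.le_induction generalizing t with
  | base =>
    obtain ⟨t, rfl⟩ : ∃ s, t = s + 1 := ⟨t - 1, by omega⟩
    rw [foldRun_first_eq hv hjK (by omega) (by omega)]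
    exact foldRun_le_half_of_lower hjK (by omega) (by omega) (by omega)
  | succ j hj ih =>
    obtain ⟨t, rfl⟩ : ∃ s, t = s + 2 := ⟨t - 2, by omega⟩
    rw [foldRun_upper hj (by omega), foldRun_fold (by omega)]
    exact max_le ((min_le_left _ _).trans (ih (by omega) (by omega) (by omega)))
      (foldRun_le_half_of_lower hjK (by omega) (by omega) (by omega))

/-- Every reflection point 2^(K-j) is at least 1/2, so the fold is now idle. -/
theorem foldRun_fold_eq (hv : ∀ j, 1 ≤ j → j ≤ K → |v j| ≤ 2 ^ K) (hj : 1 ≤ j)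
    (hjK : j ≤ K) (htj : 3 * K + 2 * j ≤ t + 1) (h : (t + 1) % 3 = 2 * j % 3) :
    foldRun K v (t + 1) j = foldRun K v t j := by
  have h1 : foldRun K v t j ≤ 1 / 2 := foldRun_le_half_of_upper hv hj hjK htj (by omega)
  have h2 : (1 : ℝ) ≤ 2 ^ (K + 1 - j) := one_le_pow₀ (by norm_num)
  rw [foldRun_fold h, min_eq_left (by linarith)]

/-- With the folds idle, only sorting of neighbours remains. If v_{j-1} ≤ v_j holds before v_j,
v_{j+1} are sorted, then v_{j-1} is below the new v_{j+1}, and so is its maximum with the new v_j.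
-/
theorem foldRun_le_succ_of_upper (hv : ∀ j, 1 ≤ j → j ≤ K → |v j| ≤ 2 ^ K) (hj : 1 ≤ j)
    (hjK : j < K) (htj : 3 * K + 2 * j + 2 ≤ t) (h : t % 3 = (2 * j + 2) % 3) :
    foldRun K v t j ≤ foldRun K v t (j + 1) := by
  induction j, hj using Nat.le_induction generalizing t with
  | base =>
    obtain ⟨t, rfl⟩ : ∃ s, t = s + 1 + 1 := ⟨t - 2, by omega⟩
    rw [foldRun_first_eq (t := t + 1) hv (by omega) (by omega) (by omega),
      foldRun_fold_eq (j := 1 + 1) hv (by omega) (by omega) (by omega) (by omega),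
      foldRun_lower hjK (by omega), foldRun_upper le_rfl (by omega)]
    exact min_le_max
  | succ j hj ih =>
    obtain ⟨t, rfl⟩ : ∃ s, t = s + 2 := ⟨t - 2, by omega⟩
    rw [foldRun_upper hj (by omega),
      foldRun_fold_eq (j := j + 1 + 1) hv (by omega) (by omega) (by omega) (by omega),
      foldRun_fold_eq hv hj (by omega) (by omega) (by omega),
      foldRun_lower hjK (by omega), foldRun_upper (j := j + 1) (by omega) (by omega)]
    exact max_le (le_max_of_le_left (ih (by omega) (by omega) (by omega))) min_le_max

/-- Second downward sweep: order above index j + 1 makes the minimum at j + 1 idle, so the order of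
v_j, v_{j+1} from the previous step survives. -/
theorem foldRun_le_succ_of_fold {t j : ℕ} (hv : ∀ j, 1 ≤ j → j ≤ K → |v j| ≤ 2 ^ K)
    (hj : 1 ≤ j) (hjK : j < K) (htj : 6 * K ≤ t + j) (h : t % 3 = 2 * j % 3) :
    foldRun K v t j ≤ foldRun K v t (j + 1) := by
  obtain ⟨t, rfl⟩ : ∃ s, t = s + 1 := ⟨t - 1, by omega⟩
  have e : foldRun K v (t + 1) (j + 1) = foldRun K v t (j + 1) := by
    obtain hK | hK := (Nat.succ_le_of_lt hjK).eq_or_lt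
    · subst hK
      have h1 : foldRun (j + 1) v t (j + 1) ≤ 1 / 2 := by
        obtain ⟨t, rfl⟩ : ∃ s, t = s + 1 := ⟨t - 1, by omega⟩
        rw [foldRun_fold_eq hv (by omega) le_rfl (by omega) (by omega)]
        exact foldRun_le_half_of_upper hv (by omega) le_rfl (by omega) (by omega)
      rw [foldRun_last (by omega), min_eq_left (by linarith)]
    · rw [foldRun_lower hK (by omega), min_eq_left]
      exact foldRun_le_succ_of_fold hv (by omega) hK (by omega) (by omega)
  rw [e, foldRun_fold_eq hv hj (by omega) (by omega) (by omega)]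
  exact foldRun_le_succ_of_upper hv hj hjK (by omega) (by omega)
termination_by K - j

/-- After `6 K - 3` steps, the numbers are sorted and lie between `0` and `1 / 2`. -/
theorem foldRun_sorted (hv : ∀ j, 1 ≤ j → j ≤ K → |v j| ≤ 2 ^ K) (hj : 1 ≤ j) (hjK : j < K) :
    foldRun K v (6 * K - 3) j ≤ foldRun K v (6 * K - 3) (j + 1) := by
  -- Since 3 divides 6K - 3, the residue of j decides which of its three phases index j is in. For
  -- residue 0 one has j ≥ 3, exactly what 6K ≤ t + j needs.
  obtain h | h | h : j % 3 = 0 ∨ j % 3 = 1 ∨ j % 3 = 2 := by omega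
  · exact foldRun_le_succ_of_fold hv hj hjK (by omega) (by omega)
  · obtain ⟨t, ht⟩ : ∃ s, 6 * K - 3 = s + 1 := ⟨6 * K - 4, by omega⟩
    rw [ht, foldRun_lower hjK (by omega), foldRun_upper hj (by omega)]
    exact min_le_max
  · exact foldRun_le_succ_of_upper hv hj hjK (by omega) (by omega)

theorem foldRun_sorted_nonneg (hv : ∀ j, 1 ≤ j → j ≤ K → |v j| ≤ 2 ^ K) (hK : 1 ≤ K) :
    0 ≤ foldRun K v (6 * K - 3) 1 :=
  foldRun_nonneg_of_lower hv le_rfl hK (by omega) (by omega)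

theorem foldRun_sorted_le_half (hv : ∀ j, 1 ≤ j → j ≤ K → |v j| ≤ 2 ^ K) (hK : 1 ≤ K) :
    foldRun K v (6 * K - 3) K ≤ 1 / 2 := by
  obtain h | h | h : K % 3 = 0 ∨ K % 3 = 1 ∨ K % 3 = 2 := by omega
  · obtain ⟨t, ht⟩ : ∃ s, 6 * K - 3 = s + 1 := ⟨6 * K - 4, by omega⟩
    rw [ht, foldRun_fold_eq hv hK le_rfl (by omega) (by omega)]
    exact foldRun_le_half_of_upper hv hK le_rfl (by omega) (by omega)
  · exact foldRun_le_half_of_lower le_rfl (by omega) (by omega) (by omega)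
  · exact foldRun_le_half_of_upper hv hK le_rfl (by omega) (by omega)

end foldRun

end PeriodicMerger

/-! ### Stages permute contents; passes of a network. -/

namespace Stage

/-- A valid stage permutes the contents of its registers. -/
theorem exists_perm_apply {α : Type u} [LinearOrder α] (S : Stage) (hS : S.IsValid) (x : ℕ → α) :
    ∃ σ : Equiv.Perm ℕ, apply S x = x ∘ σ ∧ ∀ r, r ∉ regs S → σ r = r := by
  induction S using Finset.induction_on with
  | empty =>
    refine ⟨1, ?_, fun _ _ => rfl⟩
    ext r
    exact apply_of_notMem x (by simp [regs])
  | insert c S hc ih =>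
    have hS' : IsValid S := ⟨fun d hd => hS.1 d (Finset.mem_insert_of_mem hd), fun d hd e he =>
      hS.2 d (Finset.mem_insert_of_mem hd) e (Finset.mem_insert_of_mem he)⟩
    obtain ⟨σ, hσ, hfix⟩ := ih hS'
    have hcS : ∀ d ∈ S, c.1 ≠ d.1 ∧ c.1 ≠ d.2 ∧ c.2 ≠ d.1 ∧ c.2 ≠ d.2 := fun d hd =>
      hS.2 c (Finset.mem_insert_self _ _) d (Finset.mem_insert_of_mem hd) (by rintro rfl; exact hc hd)
    have h1 : c.1 ∉ regs S := by
      simp only [regs, Finset.mem_union, Finset.mem_image, not_or, not_exists, not_and]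
      exact ⟨fun d hd h => (hcS d hd).1 h.symm, fun d hd h => (hcS d hd).2.1 h.symm⟩
    have h2 : c.2 ∉ regs S := by
      simp only [regs, Finset.mem_union, Finset.mem_image, not_or, not_exists, not_and]
      exact ⟨fun d hd h => (hcS d hd).2.2.1 h.symm, fun d hd h => (hcS d hd).2.2.2 h.symm⟩
    have hne : c.1 ≠ c.2 := hS.1 c (Finset.mem_insert_self _ _)
    have hregs : ∀ r, r ∈ regs (insert c S) ↔ r = c.1 ∨ r = c.2 ∨ r ∈ regs S := by
      intro r
      simp only [regs, Finset.mem_union, Finset.mem_image, Finset.mem_insert, exists_eq_or_imp]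
      grind
    have hother : ∀ r, r ≠ c.1 → r ≠ c.2 → apply (insert c S) x r = apply S x r := by
      intro r hr1 hr2
      by_cases hr : r ∈ regs S
      · simp only [regs, Finset.mem_union, Finset.mem_image] at hr
        obtain ⟨d, hd, rfl⟩ | ⟨d, hd, rfl⟩ := hr
        · rw [apply_fst hS x (Finset.mem_insert_of_mem hd), apply_fst hS' x hd]
        · rw [apply_snd hS x (Finset.mem_insert_of_mem hd), apply_snd hS' x hd]
      · rw [apply_of_notMem x hr, apply_of_notMem x (by rw [hregs]; tauto)]
    have hσx : ∀ r, apply S x r = x (σ r) := fun r => congrFun hσ r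
    have f1 := apply_fst hS x (Finset.mem_insert_self c S)
    have f2 := apply_snd hS x (Finset.mem_insert_self c S)
    rcases le_total (x c.1) (x c.2) with hle | hle
    · refine ⟨σ, ?_, fun r hr => hfix r fun h => hr ((hregs r).2 (Or.inr (Or.inr h)))⟩
      ext r
      by_cases hr1 : r = c.1
      · subst hr1
        rw [f1, Function.comp_apply, hfix _ h1, min_eq_left hle]
      by_cases hr2 : r = c.2
      · subst hr2
        rw [f2, Function.comp_apply, hfix _ h2, max_eq_right hle]
      · rw [hother r hr1 hr2, hσx, Function.comp_apply]
    · refine ⟨σ * Equiv.swap c.1 c.2, ?_, fun r hr => ?_⟩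
      · ext r
        by_cases hr1 : r = c.1
        · subst hr1
          rw [f1, Function.comp_apply, Equiv.Perm.mul_apply, Equiv.swap_apply_left, hfix _ h2,
            min_eq_right hle]
        by_cases hr2 : r = c.2
        · subst hr2
          rw [f2, Function.comp_apply, Equiv.Perm.mul_apply, Equiv.swap_apply_right, hfix _ h1,
            max_eq_left hle]
        · rw [hother r hr1 hr2, hσx, Function.comp_apply, Equiv.Perm.mul_apply,
            Equiv.swap_apply_of_ne_of_ne hr1 hr2]
      · rw [hregs] at hr
        push Not at hr
        rw [Equiv.Perm.mul_apply, Equiv.swap_apply_of_ne_of_ne hr.1 hr.2.1, hfix _ hr.2.2]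

theorem map_apply_eq {α : Type u} [LinearOrder α] {S : Stage} (hS : S.IsValid) {R : Finset ℕ}
    (hR : S.regs ⊆ R) (x : ℕ → α) : R.val.map (S.apply x) = R.val.map x := by
  obtain ⟨σ, hσ, hfix⟩ := S.exists_perm_apply hS x
  -- A value σ s outside R would be fixed by σ, so injectivity would give σ s = s, which lies in R.
  have hsub : R.map σ.toEmbedding ⊆ R := by
    intro r hr
    obtain ⟨s, hs, rfl⟩ := Finset.mem_map.1 hr
    by_contra h
    have h1 : σ (σ s) = σ s := hfix _ fun h' => h (hR h')
    exact h (by simpa [σ.injective h1] using hs)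
  have hmap : R.map σ.toEmbedding = R :=
    Finset.eq_of_subset_of_card_le hsub (Finset.card_map _).ge
  conv_rhs => rw [← hmap, Finset.map_val, Multiset.map_map]
  rw [hσ]
  rfl

end Stage

namespace ComparatorNetwork

theorem map_output_eq {α : Type u} [LinearOrder α] {A : ComparatorNetwork} (hA : A.IsValid)
    (x : ℕ → α) : A.registers.val.map (A.output x) = A.registers.val.map x := by
  have : ∀ d ≤ A.depth, A.registers.val.map (A.runUpTo x d) = A.registers.val.map x := by
    intro d
    induction d with
    | zero => exact fun _ => rfl
    | succ d ih =>
      intro hd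
      have h := hA (d + 1) (Finset.mem_Icc.2 ⟨by omega, hd⟩)
      rw [← ih (by omega)]
      exact Stage.map_apply_eq h.1 h.2 _
  exact this _ le_rfl

theorem IsValid.passes {A : ComparatorNetwork} (hA : A.IsValid) (t : ℕ) : (A.passes t).IsValid := by
  intro i hi
  have hi' : 1 ≤ i ∧ i ≤ t * A.depth := Finset.mem_Icc.1 hi
  have hpos : 0 < A.depth := by
    rcases Nat.eq_zero_or_pos A.depth with h | h
    · rw [h] at hi'
      omega
    · exact h
  exact hA _ (Finset.mem_Icc.2 ⟨by omega, Nat.mod_lt _ hpos⟩)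

theorem isPeriodic_passes {A : ComparatorNetwork} (hA : 0 < A.depth) {t : ℕ} (ht : 2 ≤ t) :
    (A.passes t).IsPeriodic A.depth := by
  refine ⟨?_, fun i hi _ => ?_⟩
  · change A.depth < t * A.depth
    nlinarith
  · change A.stage _ = A.stage _
    rw [show i + A.depth - 1 = i - 1 + A.depth by omega, Nat.add_mod_right]

end ComparatorNetwork

/-! ### Columns, links and levels. -/

namespace PeriodicMerger

/-- Column `c` consists of the registers `2 K i + c`. In every stage whose number is congruent to
`q` modulo `3`, the comparators connect row `i` of column `c` to row `i + δ` of column `c'`. -/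
def Link (K q c c' δ : ℕ) : Prop :=
  (1 ≤ c ∧ c ≤ K ∧ q % 3 = 2 * c % 3 ∧ c' = 2 * K + 1 - c ∧ δ = 2 ^ (K + 1 - c) - 1) ∨
  (1 ≤ c ∧ c ≤ K ∧ q % 3 = (2 * c + 1) % 3 ∧ c' = c + 1 ∧ δ = 0) ∨
  (K < c ∧ c < 2 * K ∧ q % 3 = (2 * (2 * K - c) + 1) % 3 ∧ c' = c + 1 ∧ δ = 0) ∨
  (1 ≤ K ∧ q % 3 = 1 ∧ c = 2 * K ∧ c' = 1 ∧ δ = 1)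

section Link

variable {K q c c' d d' δ ε : ℕ}

theorem Link.bounds (h : Link K q c c' δ) :
    1 ≤ c ∧ c ≤ 2 * K ∧ 1 ≤ c' ∧ c' ≤ 2 * K ∧ c ≠ c' := by
  unfold Link at h
  omega

theorem Link.eq_of_left (h : Link K q c c' δ) (h' : Link K q c d' ε) : c' = d' ∧ δ = ε := by
  unfold Link at h h'
  omega

theorem Link.eq_of_right (h : Link K q c c' δ) (h' : Link K q d c' ε) : c = d ∧ δ = ε := by
  have : c = d := by
    unfold Link at h h'
    omega
  subst this
  exact ⟨rfl, (h.eq_of_left h').2⟩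

theorem Link.false_of_left_of_right (h : Link K q c c' δ) (h' : Link K q d c ε) : False := by
  unfold Link at h h'
  omega

theorem mod_three_cases (q j : ℕ) :
    q % 3 = 2 * j % 3 ∨ q % 3 = (2 * j + 1) % 3 ∨ q % 3 = (2 * j + 2) % 3 := by
  have h1 : q % 3 = 0 ∨ q % 3 = 1 ∨ q % 3 = 2 := by omega
  have h2 : j % 3 = 0 ∨ j % 3 = 1 ∨ j % 3 = 2 := by omega
  omega

/-- Each stage matches up all 2K columns, so one of the two level rules applies to every column. -/
theorem exists_link (hc : 1 ≤ c) (hcK : c ≤ 2 * K) :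
    ∃ c' δ, Link K q c c' δ ∨ Link K q c' c δ := by
  unfold Link
  by_cases hK : c ≤ K
  · obtain h | h | h : q % 3 = 2 * c % 3 ∨ q % 3 = (2 * c + 1) % 3 ∨ q % 3 = (2 * c + 2) % 3 :=
      mod_three_cases q c
    · exact ⟨_, _, Or.inl (Or.inl ⟨hc, hK, h, rfl, rfl⟩)⟩
    · exact ⟨_, _, Or.inl (Or.inr (Or.inl ⟨hc, hK, h, rfl, rfl⟩))⟩
    · obtain rfl | h1 := hc.eq_or_lt
      · exact ⟨2 * K, 1, Or.inr (Or.inr (Or.inr (Or.inr (by omega))))⟩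
      · exact ⟨c - 1, 0, Or.inr (Or.inr (Or.inl (by omega)))⟩
  · obtain ⟨j, hj⟩ : ∃ j, j + c = 2 * K + 1 := ⟨2 * K + 1 - c, by omega⟩
    obtain h | h | h : q % 3 = 2 * j % 3 ∨ q % 3 = (2 * j + 1) % 3 ∨ q % 3 = (2 * j + 2) % 3 :=
      mod_three_cases q j
    · exact ⟨j, 2 ^ (K + 1 - j) - 1, Or.inr (Or.inl (by omega))⟩
    · obtain hj1 | hj1 : j = K ∨ j < K := by omega
      · exact ⟨c - 1, 0, Or.inr (Or.inr (Or.inl (by omega)))⟩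
      · refine ⟨c - 1, 0, Or.inr (Or.inr (Or.inr (Or.inl ?_)))⟩
        rw [show 2 * K - (c - 1) = j by omega]
        omega
    · obtain rfl | h1 := hcK.eq_or_lt
      · exact ⟨1, 1, Or.inl (Or.inr (Or.inr (Or.inr (by omega))))⟩
      · refine ⟨c + 1, 0, Or.inl (Or.inr (Or.inr (Or.inl ?_)))⟩
        rw [show 2 * K - c = j - 1 by omega]
        omega

/-- The level of column `c`, when the levels of opposite columns add up to `2 s`. -/
noncomputable def level (K : ℕ) (s : ℝ) (v : ℕ → ℝ) (c : ℕ) : ℝ :=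
  if c ≤ K then s - 1 / 2 + v c else s + 1 / 2 - v (2 * K + 1 - c)

/-- Links between opposite columns become reflections of a single offset. The remaining links come
in mirror pairs, and both members of a pair sort the same two neighbouring offsets. -/
theorem Link.level_foldStep (h : Link K q c c' δ) (s : ℝ) (v : ℕ → ℝ) :
    level K s (foldStep K q v) c = min (level K s v c) (level K s v c' + δ) ∧
      level K s (foldStep K q v) c' = max (level K s v c') (level K s v c - δ) := by
  obtain ⟨h1, h2, h3, rfl, rfl⟩ | ⟨h1, h2, h3, rfl, rfl⟩ | ⟨h1, h2, h3, rfl, rfl⟩ |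
    ⟨h0, h3, rfl, rfl, rfl⟩ := h
  · have e : 2 * K + 1 - (2 * K + 1 - c) = c := by omega
    have hp : 1 ≤ 2 ^ (K + 1 - c) := Nat.one_le_two_pow
    simp only [level, if_pos h2, if_neg (show ¬ 2 * K + 1 - c ≤ K by omega), e, foldStep, if_pos h3]
    push_cast [hp]
    constructor
    · rcases le_total (v c) (2 ^ (K + 1 - c) - v c) with h | h
      · rw [min_eq_left h, min_eq_left (by linarith)]
      · rw [min_eq_right h, min_eq_right (by linarith)]; ring
    · rcases le_total (v c) (2 ^ (K + 1 - c) - v c) with h | h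
      · rw [min_eq_left h, max_eq_left (by linarith)]
      · rw [min_eq_right h, max_eq_right (by linarith)]; ring
  · obtain rfl | hK := h2.eq_or_lt
    · have e : 2 * c + 1 - (c + 1) = c := by omega
      simp only [level, if_pos h2, if_neg (show ¬ c + 1 ≤ c by omega), e, foldStep, lt_irrefl,
        if_false, if_neg (show ¬ q % 3 = 2 * c % 3 by omega), if_pos h3]
      push_cast
      constructor
      · rcases le_total (v c) (1 - v c) with h | h
        · rw [min_eq_left h, min_eq_left (by linarith)]
        · rw [min_eq_right h, min_eq_right (by linarith)]; ring
      · rcases le_total (v c) (1 - v c) with h | h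
        · rw [min_eq_left h, max_eq_left (by linarith)]
        · rw [min_eq_right h, max_eq_right (by linarith)]; ring
    · simp only [level, if_pos h2, if_pos (show c + 1 ≤ K by omega), foldStep, if_pos hK,
        if_neg (show ¬ q % 3 = 2 * c % 3 by omega), if_pos h3,
        if_neg (show ¬ q % 3 = 2 * (c + 1) % 3 by omega),
        if_neg (show ¬ q % 3 = (2 * (c + 1) + 1) % 3 by omega),
        if_neg (show ¬ c + 1 = 1 by omega), Nat.add_sub_cancel]
      push_cast
      rw [add_zero, sub_zero, max_comm (v c)]
      exact ⟨min_add_add_left _ _ _ |>.symm, max_add_add_left _ _ _ |>.symm⟩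
  · obtain ⟨j, hj⟩ : ∃ j, j + c = 2 * K := ⟨2 * K - c, by omega⟩
    have e1 : 2 * K + 1 - c = j + 1 := by omega
    have e2 : 2 * K + 1 - (c + 1) = j := by omega
    have e3 : 2 * K - c = j := by omega
    rw [e3] at h3
    simp only [level, if_neg (show ¬ c ≤ K by omega), if_neg (show ¬ c + 1 ≤ K by omega), foldStep,
        e1, e2, if_pos (show j < K by omega),
        if_neg (show ¬ q % 3 = 2 * j % 3 by omega), if_pos h3,
        if_neg (show ¬ q % 3 = 2 * (j + 1) % 3 by omega),
        if_neg (show ¬ q % 3 = (2 * (j + 1) + 1) % 3 by omega),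
        if_neg (show ¬ j + 1 = 1 by omega), Nat.add_sub_cancel]
    push_cast
    rw [add_zero, sub_zero, max_comm (v j)]
    exact ⟨min_sub_sub_left _ _ _ |>.symm, max_sub_sub_left _ _ _ |>.symm⟩
  · have e : 2 * K + 1 - 2 * K = 1 := by omega
    simp only [level, if_pos h0, if_neg (show ¬ 2 * K ≤ K by omega), foldStep, e,
      if_neg (show ¬ q % 3 = 2 * 1 % 3 by omega), if_neg (show ¬ q % 3 = (2 * 1 + 1) % 3 by omega),
      if_true]
    push_cast
    rcases le_total 0 (v 1) with h | h
    · rw [abs_of_nonneg h]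
      exact ⟨(min_eq_left (by linarith)).symm, (max_eq_left (by linarith)).symm⟩
    · rw [abs_of_nonpos h]
      exact ⟨by rw [min_eq_right (by linarith)]; ring, by rw [max_eq_right (by linarith)]; ring⟩

end Link

theorem register_inj {b i i' c c' : ℕ} (hc : 1 ≤ c) (hcb : c ≤ b) (hc' : 1 ≤ c') (hcb' : c' ≤ b)
    (h : b * i + c = b * i' + c') : i = i' ∧ c = c' := by
  have : i = i' := by
    rcases lt_trichotomy i i' with hlt | rfl | hlt
    · nlinarith [Nat.mul_le_mul_left b hlt]
    · rfl
    · nlinarith [Nat.mul_le_mul_left b hlt]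
  subst this
  exact ⟨rfl, by omega⟩

/-- The stage consists of the comparators that are given by the links, on `n` rows. -/
def IsLinkStage (K n q : ℕ) (S : Stage) : Prop :=
  ∀ x y, (x, y) ∈ S ↔ ∃ i c c' δ, Link K q c c' δ ∧ i + δ < n ∧
    x = 2 * K * i + c ∧ y = 2 * K * (i + δ) + c'

section IsLinkStage

variable {K n q : ℕ} {S : Stage}

theorem IsLinkStage.isValid (hS : IsLinkStage K n q S) : S.IsValid := by
  refine ⟨?_, ?_⟩
  · rintro ⟨x, y⟩ hx
    obtain ⟨i, c, c', δ, hl, -, rfl, rfl⟩ := (hS x y).1 hx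
    have hb := hl.bounds
    intro h
    exact hb.2.2.2.2 (register_inj hb.1 hb.2.1 hb.2.2.1 hb.2.2.2.1 h).2
  · rintro ⟨x, y⟩ hx ⟨x', y'⟩ hx' hne
    obtain ⟨i, c, c', δ, hl, -, rfl, rfl⟩ := (hS x y).1 hx
    obtain ⟨k, d, d', ε, hm, -, rfl, rfl⟩ := (hS x' y').1 hx'
    obtain ⟨hc, hcK, hc', hcK', -⟩ := hl.bounds
    obtain ⟨hd, hdK, hd', hdK', -⟩ := hm.bounds
    refine ⟨fun h => ?_, fun h => ?_, fun h => ?_, fun h => ?_⟩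
    · obtain ⟨rfl, rfl⟩ := register_inj hc hcK hd hdK h
      obtain ⟨rfl, rfl⟩ := hl.eq_of_left hm
      exact hne rfl
    · obtain ⟨-, rfl⟩ := register_inj hc hcK hd' hdK' h
      exact hl.false_of_left_of_right hm
    · obtain ⟨-, rfl⟩ := register_inj hc' hcK' hd hdK h
      exact hm.false_of_left_of_right hl
    · obtain ⟨hi, rfl⟩ := register_inj hc' hcK' hd' hdK' h
      obtain ⟨rfl, rfl⟩ := hl.eq_of_right hm
      obtain rfl : i = k := by omega
      exact hne rfl

theorem IsLinkStage.regs_subset (hS : IsLinkStage K n q S) :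
    S.regs ⊆ Finset.Icc 1 (2 * K * n) := by
  intro r hr
  have key : ∀ i c, i < n → 1 ≤ c → c ≤ 2 * K → 2 * K * i + c ∈ Finset.Icc 1 (2 * K * n) := by
    intro i c hi hc hcK
    have := Nat.mul_le_mul_left (2 * K) (Nat.succ_le_of_lt hi)
    rw [Nat.mul_succ] at this
    exact Finset.mem_Icc.2 ⟨by omega, by omega⟩
  simp only [Stage.regs, Finset.mem_union, Finset.mem_image, Prod.exists, exists_eq_right,
    exists_and_right] at hr
  obtain ⟨y, hy⟩ | ⟨x, hx⟩ := hr
  · obtain ⟨i, c, c', δ, hl, hi, rfl, -⟩ := (hS _ _).1 hy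
    exact key _ _ (by omega) hl.bounds.1 hl.bounds.2.1
  · obtain ⟨i, c, c', δ, hl, hi, -, rfl⟩ := (hS _ _).1 hx
    exact key _ _ hi hl.bounds.2.2.1 hl.bounds.2.2.2.1

/-- The contents of column `c` that are at least `a` are those in the last rows, down from level
`C c`. -/
def HasLevels {α : Type u} [LinearOrder α] (K n : ℕ) (a : α) (x : ℕ → α) (C : ℕ → ℝ) : Prop :=
  ∀ i < n, ∀ c, 1 ≤ c → c ≤ 2 * K → (a ≤ x (2 * K * i + c) ↔ (n : ℝ) ≤ i + C c)

/-- In rows where the partner would fall outside the array there is no comparator. The bounds 0 ≤ C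
< n + 1 make the rule agree there: a missing lower partner would count as large, a missing upper one
as small. -/
theorem IsLinkStage.hasLevels_apply {α : Type u} [LinearOrder α] (hS : IsLinkStage K n q S) {a : α}
    {x : ℕ → α} {C C' : ℕ → ℝ} (hx : HasLevels K n a x C)
    (hC : ∀ c, 1 ≤ c → c ≤ 2 * K → 0 ≤ C c ∧ C c < n + 1)
    (hC' : ∀ c c' δ, Link K q c c' δ → C' c = min (C c) (C c' + δ) ∧ C' c' = max (C c') (C c - δ)) :
    HasLevels K n a (S.apply x) C' := by
  intro i hi c hc hcK
  obtain ⟨c', δ, hl | hl⟩ := exists_link (q := q) hc hcK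
  · obtain ⟨-, -, hc', hcK', -⟩ := hl.bounds
    rw [(hC' _ _ _ hl).1]
    by_cases hiδ : i + δ < n
    · have hmem : (2 * K * i + c, 2 * K * (i + δ) + c') ∈ S :=
        (hS _ _).2 ⟨i, c, c', δ, hl, hiδ, rfl, rfl⟩
      have := Stage.apply_fst hS.isValid x hmem
      simp only at this
      rw [this, le_min_iff, hx i hi c hc hcK, hx (i + δ) hiδ c' hc' hcK', ← min_add_add_left,
        le_min_iff]
      push_cast
      rw [add_assoc, add_comm (δ : ℝ)]
    · rw [Stage.apply_of_notMem, hx i hi c hc hcK, ← min_add_add_left, le_min_iff]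
      · have h1 : (n : ℝ) ≤ i + δ := by exact_mod_cast not_lt.1 hiδ
        have h2 := (hC c' hc' hcK').1
        exact ⟨fun h => ⟨h, by linarith⟩, fun h => h.1⟩
      · simp only [Stage.regs, Finset.mem_union, Finset.mem_image, Prod.exists, exists_eq_right,
          exists_and_right, not_or, not_exists]
        refine ⟨fun y hy => ?_, fun y hy => ?_⟩
        · obtain ⟨k, d, d', ε, hm, hk, h, -⟩ := (hS _ _).1 hy
          obtain ⟨rfl, rfl⟩ := register_inj hc hcK hm.bounds.1 hm.bounds.2.1 h
          obtain ⟨rfl, rfl⟩ := hl.eq_of_left hm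
          exact hiδ hk
        · obtain ⟨k, d, d', ε, hm, hk, -, h⟩ := (hS _ _).1 hy
          obtain ⟨-, rfl⟩ := register_inj hc hcK hm.bounds.2.2.1 hm.bounds.2.2.2.1 h
          exact hl.false_of_left_of_right hm
  · obtain ⟨hc', hcK', -, -, -⟩ := hl.bounds
    rw [(hC' _ _ _ hl).2]
    by_cases hiδ : δ ≤ i
    · obtain ⟨k, rfl⟩ := Nat.exists_eq_add_of_le' hiδ
      have hmem : (2 * K * k + c', 2 * K * (k + δ) + c) ∈ S :=
        (hS _ _).2 ⟨k, c', c, δ, hl, hi, rfl, rfl⟩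
      have := Stage.apply_snd hS.isValid x hmem
      simp only at this
      rw [this, le_max_iff, hx k (by omega) c' hc' hcK', hx (k + δ) hi c hc hcK, ← max_add_add_left,
        le_max_iff, or_comm]
      push_cast
      rw [add_add_sub_cancel]
    · rw [Stage.apply_of_notMem, hx i hi c hc hcK, ← max_add_add_left, le_max_iff]
      · have h1 : (i : ℝ) + 1 ≤ δ := by exact_mod_cast not_le.1 hiδ
        have h2 := (hC c' hc' hcK').2
        exact ⟨Or.inl, fun h => h.elim id fun h => by linarith⟩
      · simp only [Stage.regs, Finset.mem_union, Finset.mem_image, Prod.exists, exists_eq_right,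
          exists_and_right, not_or, not_exists]
        refine ⟨fun y hy => ?_, fun y hy => ?_⟩
        · obtain ⟨k, d, d', ε, hm, hk, h, -⟩ := (hS _ _).1 hy
          obtain ⟨-, rfl⟩ := register_inj hc hcK hm.bounds.1 hm.bounds.2.1 h
          exact hm.false_of_left_of_right hl
        · obtain ⟨k, d, d', ε, hm, hk, -, h⟩ := (hS _ _).1 hy
          obtain ⟨h', rfl⟩ := register_inj hc hcK hm.bounds.2.2.1 hm.bounds.2.2.2.1 h
          obtain ⟨rfl, rfl⟩ := hl.eq_of_right hm
          omega

end IsLinkStage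

end PeriodicMerger

/-! ### Identification of the stages of the compact form. -/

namespace PeriodicMerger

/-- The links of stage `m` of `P (K + 2)`. -/
def LinkAt (K m c c' δ : ℕ) : Prop :=
  (1 ≤ c ∧ c ≤ K ∧ m = 2 * c ∧ c' = 2 * K + 1 - c ∧ δ = 2 ^ (K + 1 - c) - 1) ∨
  (1 ≤ c ∧ c ≤ K ∧ m = 2 * c + 1 ∧ c' = c + 1 ∧ δ = 0) ∨
  (K < c ∧ c < 2 * K ∧ m = 2 * (2 * K - c) + 1 ∧ c' = c + 1 ∧ δ = 0) ∨
  (1 ≤ K ∧ m = 1 ∧ c = 2 * K ∧ c' = 1 ∧ δ = 1)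

section Network

variable {K m q c c' δ : ℕ}

theorem Link.congr {q' : ℕ} (h : q % 3 = q' % 3) : Link K q c c' δ ↔ Link K q' c c' δ := by
  simp only [Link, h]

theorem link_iff_exists_linkAt (K q c c' δ : ℕ) :
    Link K q c c' δ ↔ ∃ m, 1 ≤ m ∧ m ≤ 2 * K + 1 ∧ m % 3 = q % 3 ∧ LinkAt K m c c' δ := by
  constructor
  · rintro (h | h | h | h)
    · exact ⟨2 * c, by omega, by omega, by omega, Or.inl (by omega)⟩
    · exact ⟨2 * c + 1, by omega, by omega, by omega, Or.inr (Or.inl (by omega))⟩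
    · exact ⟨2 * (2 * K - c) + 1, by omega, by omega, by omega,
        Or.inr (Or.inr (Or.inl (by omega)))⟩
    · exact ⟨1, by omega, by omega, by omega, Or.inr (Or.inr (Or.inr (by omega)))⟩
  · rintro ⟨m, -, -, hq, h | h | h | h⟩
    · exact Or.inl ⟨h.1, h.2.1, h.2.2.1 ▸ hq.symm, h.2.2.2⟩
    · exact Or.inr (Or.inl ⟨h.1, h.2.1, h.2.2.1 ▸ hq.symm, h.2.2.2⟩)
    · exact Or.inr (Or.inr (Or.inl ⟨h.1, h.2.1, h.2.2.1 ▸ hq.symm, h.2.2.2⟩))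
    · exact Or.inr (Or.inr (Or.inr ⟨h.1, by omega, h.2.2⟩))

theorem n_add_two (K : ℕ) : n (K + 2) = 2 ^ (K + 1) - 1 := rfl

theorem b_add_two (K : ℕ) : b (K + 2) = 2 * K := rfl

theorem one_le_n (K : ℕ) : 1 ≤ n (K + 2) := by
  have h1 : 1 ≤ 2 ^ K := Nat.one_le_two_pow
  have h2 : 2 ^ (K + 1) = 2 * 2 ^ K := by ring
  rw [n_add_two]
  omega

theorem mem_firstStage (hK : 1 ≤ K) (x y : ℕ) :
    (x, y) ∈ firstStage (K + 2) ↔ ∃ i c c' δ, LinkAt K 1 c c' δ ∧ i + δ < n (K + 2) ∧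
      x = 2 * K * i + c ∧ y = 2 * K * (i + δ) + c' := by
  simp only [firstStage, Finset.mem_image, Finset.mem_Icc, Prod.mk.injEq, b_add_two]
  constructor
  · rintro ⟨i, hi, rfl, rfl⟩
    obtain ⟨i, rfl⟩ : ∃ k, i = k + 1 := ⟨i - 1, by omega⟩
    exact ⟨i, 2 * K, 1, 1, Or.inr (Or.inr (Or.inr ⟨hK, rfl, rfl, rfl, rfl⟩)), by omega,
      by ring, rfl⟩
  · rintro ⟨i, c, c', δ, h, hi, rfl, rfl⟩
    obtain ⟨rfl, rfl, rfl⟩ : c = 2 * K ∧ c' = 1 ∧ δ = 1 := by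
      unfold LinkAt at h
      omega
    exact ⟨i + 1, by omega, by ring, rfl⟩

theorem mem_longStage {j : ℕ} (hj : 1 ≤ j) (hjK : j ≤ K) (x y : ℕ) :
    (x, y) ∈ longStage (K + 2) j ↔ ∃ i c c' δ, LinkAt K (2 * j) c c' δ ∧ i + δ < n (K + 2) ∧
      x = 2 * K * i + c ∧ y = 2 * K * (i + δ) + c' := by
  have e : K + 2 - j - 1 = K + 1 - j := by omega
  have h1 : 1 ≤ 2 ^ (K + 1 - j) := Nat.one_le_two_pow
  have h2 : 2 ^ (K + 1 - j) ≤ 2 ^ K := Nat.pow_le_pow_right (by norm_num) (by omega)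
  have h3 : 2 ^ (K + 1) = 2 * 2 ^ K := by ring
  have e2 : ∀ i, i + 2 ^ (K + 1 - j) - 1 = i + (2 ^ (K + 1 - j) - 1) := fun i => by omega
  have e3 : 2 * K - j + 1 = 2 * K + 1 - j := by omega
  simp only [longStage, Finset.mem_image, Finset.mem_Icc, Prod.mk.injEq, b_add_two, e, e2, e3,
    n_add_two]
  constructor
  · rintro ⟨i, hi, rfl, rfl⟩
    exact ⟨i, j, _, _, Or.inl ⟨hj, hjK, rfl, rfl, rfl⟩, by omega, rfl, rfl⟩
  · rintro ⟨i, c, c', δ, h, hi, rfl, rfl⟩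
    obtain rfl : c = j := by
      unfold LinkAt at h
      omega
    obtain ⟨rfl, rfl⟩ : c' = 2 * K + 1 - c ∧ δ = 2 ^ (K + 1 - c) - 1 := by
      unfold LinkAt at h
      omega
    exact ⟨i, by omega, rfl, rfl⟩

theorem mem_shortStage {j : ℕ} (hj : 1 ≤ j) (hjK : j ≤ K) (x y : ℕ) :
    (x, y) ∈ shortStage (K + 2) j ↔ ∃ i c c' δ, LinkAt K (2 * j + 1) c c' δ ∧ i + δ < n (K + 2) ∧
      x = 2 * K * i + c ∧ y = 2 * K * (i + δ) + c' := by
  have hn := one_le_n K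
  simp only [shortStage, Finset.mem_union, Finset.mem_image, Finset.mem_Icc, Prod.mk.injEq,
    b_add_two]
  constructor
  · rintro (⟨i, hi, rfl, rfl⟩ | ⟨i, hi, rfl, rfl⟩)
    · exact ⟨i, j, j + 1, 0, Or.inr (Or.inl ⟨hj, hjK, rfl, rfl, rfl⟩), by omega, rfl, rfl⟩
    · refine ⟨i, 2 * K - j, 2 * K - j + 1, 0, ?_, by omega, rfl, rfl⟩
      -- For j = K both families of short comparators coincide, and they join the two central
      -- columns.
      obtain rfl | h := hjK.eq_or_lt
      · exact Or.inr (Or.inl (by omega))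
      · exact Or.inr (Or.inr (Or.inl (by omega)))
  · rintro ⟨i, c, c', δ, h, hi, rfl, rfl⟩
    obtain ⟨rfl, rfl⟩ : c' = c + 1 ∧ δ = 0 := by
      unfold LinkAt at h
      omega
    obtain rfl | rfl : c = j ∨ c = 2 * K - j := by
      unfold LinkAt at h
      omega
    · exact Or.inl ⟨i, by omega, rfl, rfl⟩
    · exact Or.inr ⟨i, by omega, rfl, rfl⟩

theorem mem_stage_P (hK : 1 ≤ K) (hm : 1 ≤ m) (hmK : m ≤ 2 * K + 1) (x y : ℕ) :
    (x, y) ∈ (P (K + 2)).stage m ↔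
      (m = 1 ∧ (x = 0 ∧ y = 1 ∨
        x = n (K + 2) * b (K + 2) ∧ y = n (K + 2) * b (K + 2) + 1)) ∨
      ∃ i c c' δ, LinkAt K m c c' δ ∧ i + δ < n (K + 2) ∧
        x = 2 * K * i + c ∧ y = 2 * K * (i + δ) + c' := by
  simp only [P]
  by_cases h1 : m = 1
  · subst h1
    rw [if_pos rfl, Finset.mem_union, mem_firstStage hK, or_comm]
    simp only [Finset.mem_insert, Finset.mem_singleton, Prod.mk.injEq, true_and]
  · simp only [h1, if_false, false_and, false_or]
    by_cases h2 : m % 2 = 0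
    · obtain ⟨j, rfl⟩ : ∃ j, m = 2 * j := ⟨m / 2, by omega⟩
      rw [if_pos h2, Nat.mul_div_cancel_left j (by norm_num), mem_longStage (by omega) (by omega)]
    · obtain ⟨j, rfl⟩ : ∃ j, m = 2 * j + 1 := ⟨m / 2, by omega⟩
      rw [if_neg h2, show (2 * j + 1) / 2 = j by omega, mem_shortStage (by omega) (by omega)]

/-- A register of column `c` is used in three consecutive stages only. -/
theorem stage_of_mem_regs (hK : 1 ≤ K) (hm : 1 ≤ m) (hmK : m ≤ 2 * K + 1) {r : ℕ}
    (hr : r ∈ ((P (K + 2)).stage m).regs) :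
    (m = 1 ∧ r = 0) ∨ ∃ i c, 1 ≤ c ∧ c ≤ 2 * K ∧ r = 2 * K * i + c ∧
      2 * min c (2 * K + 1 - c) ≤ m + 1 ∧ m ≤ 2 * min c (2 * K + 1 - c) + 1 := by
  simp only [Stage.regs, Finset.mem_union, Finset.mem_image, Prod.exists, exists_eq_right,
    exists_and_right, mem_stage_P hK hm hmK, b_add_two] at hr
  have key : ∀ c c' δ, LinkAt K m c c' δ →
      (1 ≤ c ∧ c ≤ 2 * K ∧ 2 * min c (2 * K + 1 - c) ≤ m + 1 ∧
        m ≤ 2 * min c (2 * K + 1 - c) + 1) ∧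
      (1 ≤ c' ∧ c' ≤ 2 * K ∧ 2 * min c' (2 * K + 1 - c') ≤ m + 1 ∧
        m ≤ 2 * min c' (2 * K + 1 - c') + 1) := by
    intro c c' δ h
    unfold LinkAt at h
    omega
  have hn := one_le_n K
  obtain ⟨N, hN⟩ : ∃ N, n (K + 2) = N + 1 := ⟨n (K + 2) - 1, by omega⟩
  -- Register nb is row n - 1, column 2K; the extra register nb + 1 is counted as row n, column 1.
  obtain ⟨y, ⟨rfl, ⟨rfl, -⟩ | ⟨rfl, -⟩⟩ | ⟨i, c, c', δ, hl, -, rfl, -⟩⟩ |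
    ⟨x, ⟨rfl, ⟨-, rfl⟩ | ⟨-, rfl⟩⟩ | ⟨i, c, c', δ, hl, -, -, rfl⟩⟩ := hr
  · exact Or.inl ⟨rfl, rfl⟩
  · exact Or.inr ⟨N, 2 * K, by omega, le_rfl, by rw [hN]; ring, by omega, by omega⟩
  · have h := (key c c' δ hl).1
    exact Or.inr ⟨i, c, h.1, h.2.1, rfl, h.2.2⟩
  · exact Or.inr ⟨0, 1, le_rfl, by omega, by ring, by omega, by omega⟩
  · exact Or.inr ⟨N + 1, 1, le_rfl, by omega, by rw [hN]; ring, by omega, by omega⟩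
  · have h := (key c c' δ hl).2
    exact Or.inr ⟨i + δ, c', h.1, h.2.1, rfl, h.2.2⟩

theorem le_add_two_of_mem_regs (hK : 1 ≤ K) {m m' : ℕ} (hm : 1 ≤ m) (hmK : m ≤ 2 * K + 1)
    (hm' : 1 ≤ m') (hmK' : m' ≤ 2 * K + 1) {r : ℕ} (hr : r ∈ ((P (K + 2)).stage m).regs)
    (hr' : r ∈ ((P (K + 2)).stage m').regs) : m ≤ m' + 2 := by
  obtain h | ⟨i, c, hc, hcK, h, h1, h2⟩ := stage_of_mem_regs hK hm hmK hr
  · omega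
  obtain h' | ⟨i', c', hc', hcK', h', h1', h2'⟩ := stage_of_mem_regs hK hm' hmK' hr'
  · omega
  obtain ⟨-, rfl⟩ := register_inj hc hcK hc' hcK' (h.symm.trans h')
  omega

theorem depth_P (K : ℕ) : (P (K + 2)).depth = 2 * K + 1 := by
  simp only [P]
  omega

theorem delay_P (hK : 1 ≤ K) : (P (K + 2)).delay = 3 := by
  have hmem : ∀ r m, m ∈ (P (K + 2)).usedAt r ↔
      (1 ≤ m ∧ m ≤ 2 * K + 1) ∧ r ∈ ((P (K + 2)).stage m).regs := by
    intro r m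
    rw [ComparatorNetwork.usedAt, Finset.mem_filter, Finset.mem_Icc, depth_P]
  refine le_antisymm (Finset.sup_le fun r _ => ?_) ?_
  · split_ifs with h
    · obtain ⟨h1, h2⟩ := (hmem r _).1 (Finset.max'_mem _ h)
      obtain ⟨h3, h4⟩ := (hmem r _).1 (Finset.min'_mem _ h)
      have := le_add_two_of_mem_regs hK h1.1 h1.2 h3.1 h3.2 h2 h4
      omega
    · omega
  · have hn := one_le_n K
    -- Register 1 attains the delay: [0:1] uses it in stage 1 and [1:2] in stage 3.
    have hmem1 : 1 ∈ (P (K + 2)).usedAt 1 := by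
      refine (hmem 1 1).2 ⟨by omega, Finset.mem_union_right _ (Finset.mem_image.2 ⟨(0, 1), ?_, rfl⟩)⟩
      exact (mem_stage_P hK le_rfl (by omega) 0 1).2 (Or.inl ⟨rfl, Or.inl ⟨rfl, rfl⟩⟩)
    have hmem3 : 3 ∈ (P (K + 2)).usedAt 1 := by
      refine (hmem 1 3).2 ⟨by omega, Finset.mem_union_left _ (Finset.mem_image.2 ⟨(1, 2), ?_, rfl⟩)⟩
      exact (mem_stage_P hK (by omega) (by omega) 1 2).2 (Or.inr ⟨0, 1, 2, 0,
        Or.inr (Or.inl (by omega)), by omega, by ring, by ring⟩)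
    have hreg : 1 ∈ (P (K + 2)).registers := Finset.mem_range.2 (by omega)
    refine le_trans ?_ (Finset.le_sup (f := fun r => if h : ((P (K + 2)).usedAt r).Nonempty then
      ((P (K + 2)).usedAt r).max' h - ((P (K + 2)).usedAt r).min' h + 1 else 0) hreg)
    have hne : ((P (K + 2)).usedAt 1).Nonempty := ⟨1, hmem1⟩
    simp only [dif_pos hne]
    have h1 := Finset.min'_le _ _ hmem1
    have h3 := Finset.le_max' _ _ hmem3
    omega

theorem depth_M (hK : 1 ≤ K) : (M (K + 2)).depth = 3 := delay_P hK

theorem registers_M (K : ℕ) : (M (K + 2)).registers = Finset.Icc 1 (2 * K * n (K + 2)) := by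
  ext r
  simp only [M, ComparatorNetwork.deleteRegisters, ComparatorNetwork.compactForm, P,
    Finset.mem_sdiff, Finset.mem_range, Finset.mem_insert, Finset.mem_singleton, Finset.mem_Icc,
    b_add_two, mul_comm (n (K + 2))]
  omega

/-- Stages of `P` are merged by residue modulo 3, and deleting the end registers removes exactly the
two comparators that are not links. -/
theorem isLinkStage_stage_M (hK : 1 ≤ K) (hq : 1 ≤ q) (hq3 : q ≤ 3) :
    IsLinkStage K (n (K + 2)) q ((M (K + 2)).stage q) := by
  intro x y
  simp only [M, ComparatorNetwork.deleteRegisters, ComparatorNetwork.compactForm, delay_P hK,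
    depth_P, Finset.mem_filter, Finset.mem_biUnion, Finset.mem_range, Finset.mem_insert,
    Finset.mem_singleton]
  constructor
  · rintro ⟨⟨p, hp, hmem⟩, hx, hy⟩
    obtain ⟨-, h | h⟩ | ⟨i, c, c', δ, hl, hi, rfl, rfl⟩ :=
      (mem_stage_P hK (by omega) (by omega) x y).1 hmem
    · exact absurd (Or.inl h.1) hx
    · exact absurd (Or.inr h.2) hy
    · exact ⟨i, c, c', δ, (link_iff_exists_linkAt _ _ _ _ _).2
        ⟨_, by omega, by omega, by omega, hl⟩, hi, rfl, rfl⟩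
  · rintro ⟨i, c, c', δ, hl, hi, rfl, rfl⟩
    obtain ⟨hc, hcK, hc', hcK', -⟩ := hl.bounds
    obtain ⟨m, hm, hmK, hmq, hat⟩ := (link_iff_exists_linkAt _ _ _ _ _).1 hl
    have key : ∀ i c, i < n (K + 2) → 1 ≤ c → c ≤ 2 * K →
        ¬ (2 * K * i + c = 0 ∨ 2 * K * i + c = n (K + 2) * b (K + 2) + 1) := by
      intro i c hi hc hcK
      have := Nat.mul_le_mul_left (2 * K) (Nat.succ_le_of_lt hi)
      rw [Nat.mul_succ] at this
      rw [b_add_two, mul_comm (n (K + 2))]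
      omega
    refine ⟨⟨(m - q) / 3, by omega, ?_⟩, key _ _ (by omega) hc hcK, key _ _ hi hc' hcK'⟩
    rw [show q + (m - q) / 3 * 3 = m by omega]
    exact (mem_stage_P hK hm hmK _ _).2 (Or.inr ⟨i, c, c', δ, hat, hi, rfl, rfl⟩)

theorem isValid_M (hK : 1 ≤ K) : (M (K + 2)).IsValid := by
  intro q hq
  rw [depth_M hK, Finset.mem_Icc] at hq
  have h := isLinkStage_stage_M hK hq.1 hq.2
  exact ⟨h.isValid, registers_M K ▸ h.regs_subset⟩

theorem isLinkStage_stage_passes (hK : 1 ≤ K) (t d : ℕ) :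
    IsLinkStage K (n (K + 2)) (d + 1) (((M (K + 2)).passes t).stage (d + 1)) := by
  intro x y
  have h := isLinkStage_stage_M hK (q := d % 3 + 1) (by omega) (by omega) x y
  simp only [ComparatorNetwork.passes, depth_M hK, Nat.add_sub_cancel]
  rw [h]
  simp only [Link.congr (show (d % 3 + 1) % 3 = (d + 1) % 3 by omega)]

end Network

/-! ### Initial levels and the merging property. -/

section Merge

variable {K : ℕ} {s : ℝ} {v : ℕ → ℝ}

theorem level_foldRun_bounds {L : ℝ}
    (h0 : ∀ c, 1 ≤ c → c ≤ 2 * K → 0 ≤ level K s v c ∧ level K s v c < L) (t : ℕ) :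
    ∀ c, 1 ≤ c → c ≤ 2 * K →
      0 ≤ level K s (foldRun K v t) c ∧ level K s (foldRun K v t) c < L := by
  induction t with
  | zero => exact h0
  | succ t ih =>
    intro c hc hcK
    obtain ⟨c', δ, hl | hl⟩ := exists_link (q := t + 1) hc hcK
    · obtain ⟨-, -, hc', hcK', -⟩ := hl.bounds
      rw [foldRun, (hl.level_foldStep s _).1]
      exact ⟨le_min (ih c hc hcK).1 (add_nonneg (ih c' hc' hcK').1 δ.cast_nonneg),
        (min_le_left _ _).trans_lt (ih c hc hcK).2⟩
    · obtain ⟨hc', hcK', -, -, -⟩ := hl.bounds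
      rw [foldRun, (hl.level_foldStep s _).2]
      exact ⟨le_max_of_le_left (ih c hc hcK).1,
        max_lt (ih c hc hcK).2 ((sub_le_self _ δ.cast_nonneg).trans_lt (ih c' hc' hcK').2)⟩

theorem hasLevels_runUpTo {α : Type u} [LinearOrder α] (hK : 1 ≤ K) {a : α} {x : ℕ → α}
    (hx : HasLevels K (n (K + 2)) a x (level K s v))
    (h0 : ∀ c, 1 ≤ c → c ≤ 2 * K → 0 ≤ level K s v c ∧ level K s v c < n (K + 2) + 1) (t d : ℕ) :
    HasLevels K (n (K + 2)) a (((M (K + 2)).passes t).runUpTo x d)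
      (level K s (foldRun K v d)) := by
  induction d with
  | zero => exact hx
  | succ d ih =>
    exact (isLinkStage_stage_passes hK t d).hasLevels_apply ih (level_foldRun_bounds h0 d)
      fun c c' δ hl => hl.level_foldStep s _

theorem exists_register {r N : ℕ} (hr : 1 ≤ r) (hrN : r ≤ 2 * K * N) :
    ∃ i c, i < N ∧ 1 ≤ c ∧ c ≤ 2 * K ∧ r = 2 * K * i + c := by
  have hK : 0 < 2 * K := by
    rcases Nat.eq_zero_or_pos (2 * K) with h | h
    · rw [h] at hrN
      omega
    · exact h
  have h1 := Nat.div_add_mod (r - 1) (2 * K)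
  have h2 := Nat.mod_lt (r - 1) hK
  refine ⟨(r - 1) / (2 * K), (r - 1) % (2 * K) + 1, ?_, by omega, by omega, by omega⟩
  exact (Nat.div_lt_iff_lt_mul hK).2 (by rw [mul_comm]; omega)

theorem exists_threshold (N : ℕ) (p : ℕ → Prop)
    (hp : ∀ m m', m ≤ m' → m' < N → p m → p m') :
    ∃ o ≤ N, ∀ m < N, p m ↔ N ≤ m + o := by
  classical
  have hex : ∃ m, N ≤ m ∨ p m := ⟨N, Or.inl le_rfl⟩
  have hle : Nat.find hex ≤ N := Nat.find_min' hex (Or.inl le_rfl)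
  refine ⟨N - Nat.find hex, by omega, fun m hm => ⟨fun h => ?_, fun h => ?_⟩⟩
  · have := Nat.find_min' hex (Or.inr h)
    omega
  · have hfm : Nat.find hex ≤ m := by omega
    obtain h' | h' := Nat.find_spec hex
    · omega
    · exact hp _ _ hfm hm h'

/-- Half the sum of the levels of opposite columns, if `o` and `e` items in the odd and in the even
registers, respectively, are large. -/
noncomputable def centre (K o e : ℕ) : ℝ := ((o + e) / K + 1 - 1 / (2 * K)) / 2

/-- The initial values of the folding dynamics, if `o` and `e` items in the odd and in the even
registers, respectively, are large. -/
noncomputable def offset (K o e j : ℕ) : ℝ :=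
  if Odd j then (2 * (o - e) + 2 * j - 1) / (4 * K) else (2 * (e - o) + 2 * j - 1) / (4 * K)

/-- The closed form of the initial levels. For even c the direct count gives c - 2 in place of c -
1; the extra 1/(2K) affects no row and makes both parities alike. -/
theorem level_offset {o e c : ℕ} (hK : 1 ≤ K) (hcK : c ≤ 2 * K) :
    level K (centre K o e) (offset K o e) c =
      if Odd c then (2 * o + c - 1 : ℝ) / (2 * K) else (2 * e + c - 1 : ℝ) / (2 * K) := by
  have hK0 : (K : ℝ) ≠ 0 := by positivity
  by_cases h : c ≤ K
  · rw [level, if_pos h, offset, centre]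
    split_ifs <;> field_simp <;> ring
  · have hodd : Odd (2 * K + 1 - c) ↔ ¬ Odd c := by
      simp only [Nat.odd_iff]
      omega
    rw [level, if_neg h, offset, centre]
    simp only [hodd]
    push_cast [show c ≤ 2 * K + 1 by omega]
    split_ifs <;> first | contradiction | (field_simp; ring)

/-- The choice n = 2^(K+1) - 1 enters here: the numerator is at most 2Kn + 2K - 1 < 4K · 2^K. -/
theorem abs_offset_le {o e j : ℕ} (hK : 1 ≤ K) (ho : o ≤ K * n (K + 2)) (he : e ≤ K * n (K + 2))
    (hj : 1 ≤ j) (hjK : j ≤ K) : |offset K o e j| ≤ 2 ^ K := by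
  have hn : ((n (K + 2) : ℕ) : ℝ) = 2 * 2 ^ K - 1 := by
    rw [n_add_two, Nat.cast_sub Nat.one_le_two_pow]
    push_cast
    ring
  have ho' : (o : ℝ) ≤ K * (2 * 2 ^ K - 1) := by
    rw [← hn]
    exact_mod_cast ho
  have he' : (e : ℝ) ≤ K * (2 * 2 ^ K - 1) := by
    rw [← hn]
    exact_mod_cast he
  have hK' : (1 : ℝ) ≤ K := by exact_mod_cast hK
  have hj' : (1 : ℝ) ≤ j := by exact_mod_cast hj
  have hjK' : (j : ℝ) ≤ K := by exact_mod_cast hjK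
  have h0 : (0 : ℝ) ≤ o := o.cast_nonneg
  have h0' : (0 : ℝ) ≤ e := e.cast_nonneg
  rw [abs_le, offset]
  split_ifs <;> rw [le_div_iff₀ (by positivity), div_le_iff₀ (by positivity)] <;>
    constructor <;> linarith

theorem hasLevels_of_monotoneOn {α : Type u} [LinearOrder α] (hK : 1 ≤ K) (N : ℕ) (a : α)
    {x : ℕ → α} (hodd : MonotoneOn x {r | r ∈ Finset.Icc 1 (2 * K * N) ∧ Odd r})
    (heven : MonotoneOn x {r | r ∈ Finset.Icc 1 (2 * K * N) ∧ Even r}) :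
    ∃ o ≤ K * N, ∃ e ≤ K * N, HasLevels K N a x (level K (centre K o e) (offset K o e)) := by
  have hN : 2 * K * N = 2 * (K * N) := by ring
  obtain ⟨o, ho, hpo⟩ := exists_threshold (K * N) (fun m => a ≤ x (2 * m + 1))
    fun m m' hm hm' h => h.trans (hodd ⟨Finset.mem_Icc.2 (by omega), by simp⟩
      ⟨Finset.mem_Icc.2 (by omega), by simp⟩ (by omega))
  obtain ⟨e, he, hpe⟩ := exists_threshold (K * N) (fun m => a ≤ x (2 * m + 2))
    fun m m' hm hm' h => h.trans (heven ⟨Finset.mem_Icc.2 (by omega), by simp [parity_simps]⟩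
      ⟨Finset.mem_Icc.2 (by omega), by simp [parity_simps]⟩ (by omega))
  refine ⟨o, ho, e, he, fun i hi c hc hcK => ?_⟩
  have hiN : K * i + K ≤ K * N := by
    rw [← Nat.mul_succ]
    exact Nat.mul_le_mul_left K hi
  have hK0 : (0 : ℝ) < 2 * K := by positivity
  rw [level_offset hK hcK, ← sub_le_iff_le_add']
  split_ifs with h
  · obtain ⟨d, rfl⟩ := h
    rw [show 2 * K * i + (2 * d + 1) = 2 * (K * i + d) + 1 by ring, hpo _ (by omega),
      le_div_iff₀ hK0, ← Nat.cast_le (α := ℝ)]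
    push_cast
    constructor <;> intro h <;> linarith
  · obtain ⟨d, rfl⟩ : ∃ d, c = 2 * d + 2 := by
      obtain ⟨d, hd⟩ := Nat.not_odd_iff_even.1 h
      exact ⟨d - 1, by omega⟩
    rw [show 2 * K * i + (2 * d + 2) = 2 * (K * i + d) + 2 by ring, hpe _ (by omega),
      le_div_iff₀ hK0]
    -- By parity, the extra 1 on the right does not matter.
    have : K * N ≤ K * i + d + e ↔ 2 * (K * N) ≤ 2 * (K * i) + 2 * e + 2 * d + 1 := by omega
    rw [this, ← Nat.cast_le (α := ℝ)]
    push_cast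
    constructor <;> intro h <;> linarith

/-- If the numbers `w 1, …, w K` are sorted and lie between `0` and `1 / 2`, then the levels that
belong to them describe sorted contents of the registers. -/
theorem level_add_le_level_add {w : ℕ → ℝ} (hw : ∀ j, 1 ≤ j → j < K → w j ≤ w (j + 1))
    (h0 : 0 ≤ w 1) (h1 : w K ≤ 1 / 2) {i c i' c' : ℕ} (hc : 1 ≤ c) (hcK : c ≤ 2 * K) (hc' : 1 ≤ c')
    (hcK' : c' ≤ 2 * K) (h : 2 * K * i + c ≤ 2 * K * i' + c') :
    i + level K s w c ≤ i' + level K s w c' := by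
  have hmono : ∀ j j', 1 ≤ j → j ≤ j' → j' ≤ K → w j ≤ w j' := by
    intro j j' hj hjj'
    induction j', hjj' using Nat.le_induction with
    | base => exact fun _ => le_rfl
    | succ k hk ih => exact fun hkK => (ih (by omega)).trans (hw k (by omega) (by omega))
  have hw0 : ∀ j, 1 ≤ j → j ≤ K → 0 ≤ w j := fun j hj hjK => h0.trans (hmono 1 j le_rfl hj hjK)
  have hw1 : ∀ j, 1 ≤ j → j ≤ K → w j ≤ 1 / 2 := fun j hj hjK => (hmono j K hj hjK le_rfl).trans h1
  rcases lt_trichotomy i i' with hlt | rfl | hlt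
  · have hi : (i : ℝ) + 1 ≤ i' := by exact_mod_cast hlt
    have hu : level K s w c ≤ s + 1 / 2 := by
      rw [level]
      split_ifs with hc1
      · linarith [hw1 c hc hc1]
      · linarith [hw0 (2 * K + 1 - c) (by omega) (by omega)]
    have hl : s - 1 / 2 ≤ level K s w c' := by
      rw [level]
      split_ifs with hc1
      · linarith [hw0 c' hc' hc1]
      · linarith [hw1 (2 * K + 1 - c') (by omega) (by omega)]
    linarith
  · have hcc : c ≤ c' := by omega
    gcongr
    rw [level, level]
    split_ifs with h1 h2 h2
    · linarith [hmono c c' hc hcc h2]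
    · linarith [hw1 c hc h1, hw1 (2 * K + 1 - c') (by omega) (by omega)]
    · omega
    · linarith [hmono (2 * K + 1 - c') (2 * K + 1 - c) (by omega) (by omega) (by omega)]
  · have := Nat.mul_le_mul_left (2 * K) (Nat.succ_le_of_lt hlt)
    rw [Nat.mul_succ] at this
    omega

theorem mergesOddEven_passes (hK : 1 ≤ K) :
    ((M (K + 2)).passes (2 * K - 1)).MergesOddEven.{u} := by
  intro α _ x hodd heven
  refine ⟨?_, ComparatorNetwork.map_output_eq ((isValid_M hK).passes _) x⟩
  have hreg : ((M (K + 2)).passes (2 * K - 1)).registers = Finset.Icc 1 (2 * K * n (K + 2)) :=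
    registers_M K
  have hdepth : ((M (K + 2)).passes (2 * K - 1)).depth = 6 * K - 3 := by
    simp only [ComparatorNetwork.passes, depth_M hK]
    omega
  rw [hreg] at hodd heven ⊢
  intro r hr r' hr' hrr'
  rw [Set.mem_ofPred_eq, Finset.mem_Icc] at hr hr'
  obtain ⟨i, c, hi, hc, hcK, rfl⟩ := exists_register hr.1 hr.2
  obtain ⟨i', c', hi', hc', hcK', rfl⟩ := exists_register hr'.1 hr'.2
  -- The threshold is the final content of the earlier register; it remains to see that the later
  -- one is also large.
  obtain ⟨o, ho, e, he, hx⟩ := hasLevels_of_monotoneOn hK (n (K + 2))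
    (((M (K + 2)).passes (2 * K - 1)).output x (2 * K * i + c)) hodd heven
  have hK0 : (0 : ℝ) < 2 * K := by positivity
  have hbound : ∀ c, 1 ≤ c → c ≤ 2 * K →
      0 ≤ level K (centre K o e) (offset K o e) c ∧
        level K (centre K o e) (offset K o e) c < n (K + 2) + 1 := by
    intro c hc hcK
    have ho' : (o : ℝ) ≤ K * n (K + 2) := by exact_mod_cast ho
    have he' : (e : ℝ) ≤ K * n (K + 2) := by exact_mod_cast he
    have hc' : (1 : ℝ) ≤ c := by exact_mod_cast hc
    have hcK' : (c : ℝ) ≤ 2 * K := by exact_mod_cast hcK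
    have h0 : (0 : ℝ) ≤ o := o.cast_nonneg
    have h0' : (0 : ℝ) ≤ e := e.cast_nonneg
    rw [level_offset hK hcK]
    split_ifs <;> rw [div_lt_iff₀ hK0] <;>
      exact ⟨div_nonneg (by linarith) hK0.le, by linarith⟩
  have hout := hasLevels_runUpTo hK hx hbound (2 * K - 1) (6 * K - 3)
  have hv : ∀ j, 1 ≤ j → j ≤ K → |offset K o e j| ≤ 2 ^ K := fun j hj hjK =>
    abs_offset_le hK ho he hj hjK
  have hle : (i : ℝ) + _ ≤ i' + _ := level_add_le_level_add (s := centre K o e)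
    (fun j => foldRun_sorted hv) (foldRun_sorted_nonneg hv hK) (foldRun_sorted_le_half hv hK)
    hc hcK hc' hcK' hrr'
  rw [ComparatorNetwork.output, hdepth] at hout ⊢
  exact (hout i' hi' c' hc' hcK').2 (((hout i hi c hc hcK).1 le_rfl).trans hle)

end Merge

end PeriodicMerger

/-! ### The main theorem. -/

theorem theorem1 (k : ℕ) (hk : 3 ≤ k) :
    -- `M_k` is a comparator network with three stages on the registers `1, …, N_k`
    (PeriodicMerger.M k).IsValid ∧
    (PeriodicMerger.M k).depth = 3 ∧
    (PeriodicMerger.M k).registers = Finset.Icc 1 ((2 ^ k - 2) * (k - 2)) ∧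
    -- applied repeatedly, it is a 3-periodic network
    (∀ t : ℕ, 2 ≤ t → ((PeriodicMerger.M k).passes t).IsPeriodic 3) ∧
    -- `2k - 5` passes merge
    ((PeriodicMerger.M k).passes (2 * k - 5)).MergesOddEven.{u} ∧
    -- the running time
    (((PeriodicMerger.M k).passes (2 * k - 5)).depth : ℝ) = 6 * (k : ℝ) - 15 ∧
    6 * (k : ℝ) - 15 ≤ 6 * Real.logb 2 (((2 : ℝ) ^ k - 2) * ((k : ℝ) - 2)) := by
  obtain ⟨K, rfl⟩ : ∃ K, k = K + 2 := ⟨k - 2, by omega⟩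
  have hK : 1 ≤ K := by omega
  have hdepth := PeriodicMerger.depth_M hK
  have hpasses : 2 * (K + 2) - 5 = 2 * K - 1 := by omega
  refine ⟨PeriodicMerger.isValid_M hK, hdepth, ?_, fun t ht => ?_, ?_, ?_, ?_⟩
  · rw [PeriodicMerger.registers_M, PeriodicMerger.n_add_two, Nat.add_sub_cancel,
      show 2 ^ (K + 2) - 2 = 2 * (2 ^ (K + 1) - 1) by rw [pow_succ _ (K + 1)]; omega]
    congr 1
    ring
  · have := ComparatorNetwork.isPeriodic_passes (A := PeriodicMerger.M (K + 2)) (by omega) ht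
    rwa [hdepth] at this
  · rw [hpasses]
    exact PeriodicMerger.mergesOddEven_passes hK
  · have : ((PeriodicMerger.M (K + 2)).passes (2 * K - 1)).depth + 3 = 6 * K := by
      simp only [ComparatorNetwork.passes, hdepth]
      omega
    have h : (((PeriodicMerger.M (K + 2)).passes (2 * K - 1)).depth : ℝ) + 3 = 6 * K := by
      exact_mod_cast this
    rw [hpasses]
    push_cast
    linarith
  · have h2 : (2 : ℝ) ≤ 2 ^ (K + 1) := by
      calc (2 : ℝ) = 2 ^ 1 := by norm_num
        _ ≤ 2 ^ (K + 1) := pow_le_pow_right₀ (by norm_num) (by omega)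
    have hK' : (1 : ℝ) ≤ K := by exact_mod_cast hK
    -- The crude bound N_k ≥ 2^(k-1) suffices, since 6k - 15 ≤ 6(k - 1).
    have hle : (2 : ℝ) ^ (K + 1) ≤ (2 ^ (K + 2) - 2) * (((K + 2 : ℕ) : ℝ) - 2) := by
      rw [pow_succ _ (K + 1)]
      push_cast
      nlinarith
    have hlog : ((K + 1 : ℕ) : ℝ) ≤
        Real.logb 2 ((2 ^ (K + 2) - 2) * (((K + 2 : ℕ) : ℝ) - 2)) := by
      rw [Real.le_logb_iff_rpow_le (by norm_num) (by linarith), Real.rpow_natCast]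
      exact hle
    push_cast at hlog ⊢
    linarith
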